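/- Let $d$ be a natural number and write $\langle u,z\rangle=\sum_{j=1}^d u_j\overline{z_j}$ and $|z|^2=\langle z,z\rangle$ for $u,z\in\mathbb C^d$. Let $\mathcal F^2(\mathbb C^d)$ be the Fock space: the Hilbert space of all entire functions $f$ on $\mathbb C^d$ with $\frac1{\pi^d}\int_{\mathbb C^d}|f(z)|^2e^{-|z|^2}\,dV(z)<\infty$ ($dV$ is Lebesgue measure), with inner product $\langle f,g\rangle=\frac1{\pi^d}\int_{\mathbb C^d}f(z)\overline{g(z)}e^{-|z|^2}\,dV(z)$. It contains the kernel functions $K_z(u)=e^{\langle u,z\rangle}$, $z\in\mathbb C^d$. Let $\psi$ be a nonzero entire function on $\mathbb C^d$ and $\varphi:\mathbb C^d\to\mathbb C^d$ a holomorphic mapping. Let $C_{\psi,\varphi,\max}$ be the maximal weighted composition operator: its domain is the set of all $f\in\mathcal F^2(\mathbb C^d)$ with $\psi\cdot(f\circ\varphi)\in\mathcal F^2(\mathbb C^d)$, and $C_{\psi,\varphi,\max}f=\psi\cdot(f\circ\varphi)$ on this domain. For unbounded operators, $T^*$ denotes the Hilbert space adjoint, and $T\preceq S$ means that $\operatorname{dom}(T)\subseteq\operatorname{dom}(S)$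 and $Tf=Sf$ for all $f\in\operatorname{dom}(T)$. Assume that $\operatorname{dom}(C_{\psi,\varphi,\max})$ contains all kernel functions $K_z$, $z\in\mathbb C^d$. Then the following are equivalent: 1. $C_{\psi,\varphi,\max}=C_{\psi,\varphi,\max}^*$ (respectively, $C_{\psi,\varphi,\max}=-C_{\psi,\varphi,\max}^*$); 2. $C_{\psi,\varphi,\max}\preceq C_{\psi,\varphi,\max}^*$ (respectively, $C_{\psi,\varphi,\max}\preceq-C_{\psi,\varphi,\max}^*$); 3. there are a $d\times d$ complex matrix $Q$ with $Q=Q^*$, a vector $q\in\mathbb C^d$ and a number $\theta\in\mathbb R$ (respectively, $\theta\in i\mathbb R$) such that $\psi(z)=\theta e^{\langle z,q\rangle}$ and $\varphi(z)=Qz+q$ for all $z\in\mathbb C^d$. -/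

import Mathlib

open MeasureTheory Filter Topology Metric
open scoped ENNReal ComplexConjugate

noncomputable section

/-- The complex Euclidean space `ℂ^d`. Mathlib's `inner ℂ x y` is `∑ j, conj (x j) * y j`, that is,
`⟨y, x⟩` in the convention where the inner product is linear in its first argument. -/
abbrev Cd (d : ℕ) : Type := EuclideanSpace ℂ (Fin d)

/-- The Gaussian measure `π^{-d} e^{-|z|²} dV(z)` on `ℂ^d`, where `dV` is Lebesgue measure. -/
def fockMeasure (d : ℕ) : Measure (Cd d) :=
  volume.withDensity fun z => ENNReal.ofReal (Real.exp (-‖z‖ ^ 2) / Real.pi ^ d)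

/-- The entire functions on `ℂ^d` that are square-integrable for the Gaussian measure, as a linear
subspace of the space of all functions. -/
def fockSubmodule (d : ℕ) : Submodule ℂ (Cd d → ℂ) where
  carrier := {f | Differentiable ℂ f ∧ MemLp f 2 (fockMeasure d)}
  zero_mem' := ⟨differentiable_const 0, MemLp.zero⟩
  add_mem' hf hg := ⟨hf.1.add hg.1, hf.2.add hg.2⟩
  smul_mem' c _ hf := ⟨hf.1.const_smul c, hf.2.const_smul c⟩

/-- The Fock space on `ℂ^d`. -/
def Fock (d : ℕ) : Type := fockSubmodule d

namespace Fock

variable {d : ℕ}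

instance : AddCommGroup (Fock d) := inferInstanceAs (AddCommGroup (fockSubmodule d))

instance : Module ℂ (Fock d) := inferInstanceAs (Module ℂ (fockSubmodule d))

instance : FunLike (Fock d) (Cd d) ℂ where
  coe f := f.1
  coe_injective _ _ h := Subtype.ext h

/-- An element of the Fock space from a function with the defining properties. -/
def mk (f : Cd d → ℂ) (hf : f ∈ fockSubmodule d) : Fock d := ⟨f, hf⟩

@[simp] theorem coe_mk (f : Cd d → ℂ) (hf : f ∈ fockSubmodule d) : ⇑(mk f hf) = f := rfl

@[simp] theorem coe_add (f g : Fock d) : ⇑(f + g) = ⇑f + ⇑g := rfl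

@[simp] theorem coe_sub (f g : Fock d) : ⇑(f - g) = ⇑f - ⇑g := rfl

@[simp] theorem coe_zero : ⇑(0 : Fock d) = 0 := rfl

@[simp] theorem coe_smul (c : ℂ) (f : Fock d) : ⇑(c • f) = c • ⇑f := rfl

theorem mem (f : Fock d) : ⇑f ∈ fockSubmodule d := f.2

theorem differentiable (f : Fock d) : Differentiable ℂ f := f.2.1

theorem memLp (f : Fock d) : MemLp f 2 (fockMeasure d) := f.2.2

end Fock

theorem fockDensity_pos {d : ℕ} (z : Cd d) : 0 < Real.exp (-‖z‖ ^ 2) / Real.pi ^ d := by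
  positivity

theorem fockDensity_measurable (d : ℕ) :
    Measurable fun z : Cd d => ENNReal.ofReal (Real.exp (-‖z‖ ^ 2) / Real.pi ^ d) := by
  fun_prop

theorem volume_ac_fockMeasure (d : ℕ) : (volume : Measure (Cd d)) ≪ fockMeasure d :=
  withDensity_absolutelyContinuous' (fockDensity_measurable d).aemeasurable
    (Eventually.of_forall fun z => (ENNReal.ofReal_pos.2 (fockDensity_pos z)).ne')

/-- Continuous functions that agree almost everywhere for the Gaussian measure are equal. -/
theorem eq_of_ae_eq_fockMeasure {d : ℕ} {f g : Cd d → ℂ} (hf : Continuous f) (hg : Continuous g)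
    (h : f =ᵐ[fockMeasure d] g) : f = g :=
  Measure.eq_of_ae_eq ((volume_ac_fockMeasure d).ae_eq h) hf hg

namespace Fock

variable {d : ℕ}

/-- The class of a Fock space function in `L²` of the Gaussian measure. -/
def toL2 : Fock d →ₗ[ℂ] Lp ℂ 2 (fockMeasure d) where
  toFun f := f.memLp.toLp f
  map_add' f g := f.memLp.toLp_add g.memLp
  map_smul' c f := f.memLp.toLp_const_smul c

theorem coeFn_toL2 (f : Fock d) : toL2 f =ᵐ[fockMeasure d] f := f.memLp.coeFn_toLp

theorem toL2_injective : Function.Injective (toL2 (d := d)) := by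
  intro f g h
  apply DFunLike.coe_injective
  apply eq_of_ae_eq_fockMeasure f.differentiable.continuous g.differentiable.continuous
  exact (coeFn_toL2 f).symm.trans (h ▸ coeFn_toL2 g)

theorem inner_toL2 (f g : Fock d) :
    inner ℂ (toL2 f) (toL2 g) = ∫ z, conj (f z) * g z ∂(fockMeasure d) := by
  rw [L2.inner_def]
  apply integral_congr_ae
  filter_upwards [coeFn_toL2 f, coeFn_toL2 g] with z h1 h2
  rw [h1, h2, RCLike.inner_apply, mul_comm]

/-- The inner product of the Fock space, `∫ conj (f z) * g z * π^{-d} e^{-|z|²} dV(z)` in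
Mathlib's convention (conjugate-linear in the first argument). -/
instance instCore : InnerProductSpace.Core ℂ (Fock d) where
  inner f g := ∫ z, conj (f z) * g z ∂(fockMeasure d)
  conj_inner_symm f g := by
    rw [← inner_toL2, ← inner_toL2]; exact inner_conj_symm _ _
  re_inner_nonneg f := by
    rw [← inner_toL2]; exact inner_self_nonneg
  add_left f g h := by
    rw [← inner_toL2, ← inner_toL2, ← inner_toL2, map_add, inner_add_left]
  smul_left f g c := by
    rw [← inner_toL2, ← inner_toL2, map_smul, inner_smul_left]
  definite f hf := by
    rw [← inner_toL2] at hf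
    exact toL2_injective (by rw [inner_self_eq_zero.1 hf, map_zero])

instance : NormedAddCommGroup (Fock d) :=
  InnerProductSpace.Core.toNormedAddCommGroup (𝕜 := ℂ) (F := Fock d)

instance : InnerProductSpace ℂ (Fock d) := InnerProductSpace.ofCore instCore.toCore

theorem inner_eq (f g : Fock d) : inner ℂ f g = ∫ z, conj (f z) * g z ∂(fockMeasure d) := rfl

/-- The Fock space is isometrically embedded in `L²` of the Gaussian measure. -/
def toL2Isometry : Fock d →ₗᵢ[ℂ] Lp ℂ 2 (fockMeasure d) where
  toLinearMap := toL2
  norm_map' f := by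
    have h : inner ℂ (toL2 f) (toL2 f) = inner ℂ f f := by rw [inner_toL2, inner_eq]
    rw [inner_self_eq_norm_sq_to_K, inner_self_eq_norm_sq_to_K] at h
    have h2 : ‖toL2 f‖ ^ 2 = ‖f‖ ^ 2 := by exact_mod_cast h
    exact (sq_eq_sq₀ (norm_nonneg _) (norm_nonneg _)).1 h2

end Fock

/-! ### Completeness of the Fock space -/

/-- The mean value property of an entire function along a circle in a complex line. -/
theorem circle_mean_entire {d : ℕ} {f : Cd d → ℂ} (hf : Differentiable ℂ f) (z w : Cd d) :
    ∫ θ in (0 : ℝ)..2 * Real.pi, f (z + circleMap 0 1 θ • w) = (2 * Real.pi : ℝ) • f z := by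
  have h : Real.circleAverage (fun t : ℂ => f (z + t • w)) 0 1 = f (z + (0 : ℂ) • w) :=
    DiffContOnCl.circleAverage
      (Differentiable.diffContOnCl (by fun_prop : Differentiable ℂ fun t : ℂ => f (z + t • w)))
  rw [Real.circleAverage_def, zero_smul, add_zero] at h
  rw [← h, smul_smul, mul_inv_cancel₀ (by positivity), one_smul]

/-- Rotations preserve integrals over balls centred at the origin. -/
theorem setIntegral_ball_rotate {d : ℕ} (g : Cd d → ℂ) (c : ℂ) (hc : ‖c‖ = 1) :
    ∫ w in ball (0 : Cd d) 1, g (c • w) = ∫ w in ball (0 : Cd d) 1, g w := by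
  have hc0 : c ≠ 0 := by rintro rfl; simp at hc
  let e : Cd d ≃ₗᵢ[ℝ] Cd d :=
    { toLinearEquiv := (LinearEquiv.smulOfNeZero ℂ (Cd d) c hc0).restrictScalars ℝ
      norm_map' := fun x => by
        change ‖c • x‖ = ‖x‖
        rw [norm_smul, hc, one_mul] }
  have he := e.measurePreserving
  have hpre : e ⁻¹' ball (0 : Cd d) 1 = ball (0 : Cd d) 1 := by
    ext x; simp
  have := he.setIntegral_preimage_emb e.toHomeomorph.measurableEmbedding g (ball (0 : Cd d) 1)
  rw [hpre] at this
  exact this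

/-- The mean value property of an entire function on a unit ball. -/
theorem ball_mean_entire {d : ℕ} {f : Cd d → ℂ} (hf : Differentiable ℂ f) (z : Cd d) :
    ∫ w in ball (0 : Cd d) 1, f (z + w) = (volume.real (ball (0 : Cd d) 1)) • f z := by
  have hpi : (2 * Real.pi : ℝ) ≠ 0 := by positivity
  have h0 : (0 : ℝ) ≤ 2 * Real.pi := by positivity
  have h1 : ∫ θ in (0 : ℝ)..2 * Real.pi, ∫ w in ball (0 : Cd d) 1,
      f (z + circleMap 0 1 θ • w) = (2 * Real.pi : ℝ) • ∫ w in ball (0 : Cd d) 1, f (z + w) := by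
    have : ∀ θ : ℝ, ∫ w in ball (0 : Cd d) 1, f (z + circleMap 0 1 θ • w)
        = ∫ w in ball (0 : Cd d) 1, f (z + w) := fun θ =>
      setIntegral_ball_rotate (fun w => f (z + w)) _ (by simp)
    simp [this]
  have h2 : ∫ θ in (0 : ℝ)..2 * Real.pi, ∫ w in ball (0 : Cd d) 1,
      f (z + circleMap 0 1 θ • w) = ∫ w in ball (0 : Cd d) 1, ∫ θ in (0 : ℝ)..2 * Real.pi,
      f (z + circleMap 0 1 θ • w) := by
    simp only [intervalIntegral.integral_of_le h0]
    apply integral_integral_swap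
    rw [Measure.prod_restrict]
    have hcont : Continuous (Function.uncurry fun (θ : ℝ) (w : Cd d) =>
        f (z + circleMap 0 1 θ • w)) := by
      have := hf.continuous
      have h3 : Continuous (circleMap 0 1) := continuous_circleMap 0 1
      unfold Function.uncurry
      fun_prop
    have hK : IsCompact (Set.Icc (0 : ℝ) (2 * Real.pi) ×ˢ closedBall (0 : Cd d) 1) :=
      isCompact_Icc.prod (isCompact_closedBall 0 1)
    exact (hcont.continuousOn.integrableOn_compact hK).mono_set
      (Set.prod_mono Set.Ioc_subset_Icc_self ball_subset_closedBall)
  rw [h1] at h2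
  simp only [circle_mean_entire hf] at h2
  rw [setIntegral_const, smul_comm] at h2
  exact smul_right_injective ℂ hpi h2

theorem Fock.norm_eq {d : ℕ} (f : Fock d) : ‖f‖ = (eLpNorm f 2 (fockMeasure d)).toReal := by
  rw [← Fock.toL2Isometry.norm_map f]
  exact Lp.norm_toLp _ f.memLp

/-- On a ball, Lebesgue measure is bounded by a multiple of the Gaussian measure. -/
theorem volume_restrict_ball_le (d : ℕ) (r : ℝ) :
    ∃ c : ℝ≥0∞, c ≠ ∞ ∧
      (volume : Measure (Cd d)).restrict (ball 0 r) ≤ c • fockMeasure d := by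
  refine ⟨ENNReal.ofReal (Real.exp (r ^ 2) * Real.pi ^ d), ENNReal.ofReal_ne_top, ?_⟩
  rw [Measure.le_iff]
  intro s hs
  rw [Measure.restrict_apply hs, Measure.smul_apply, smul_eq_mul, fockMeasure,
    withDensity_apply _ hs, ← lintegral_const_mul _ (fockDensity_measurable d)]
  have hm : MeasurableSet (s ∩ ball (0 : Cd d) r) := hs.inter measurableSet_ball
  calc volume (s ∩ ball (0 : Cd d) r) = ∫⁻ _ in s ∩ ball (0 : Cd d) r, 1 := by simp
    _ ≤ ∫⁻ z in s ∩ ball (0 : Cd d) r, ENNReal.ofReal (Real.exp (r ^ 2) * Real.pi ^ d) *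
          ENNReal.ofReal (Real.exp (-‖z‖ ^ 2) / Real.pi ^ d) := by
        apply setLIntegral_mono' hm
        intro z hz
        have hz' : ‖z‖ < r := by simpa using hz.2
        rw [← ENNReal.ofReal_mul (by positivity), ← ENNReal.ofReal_one]
        apply ENNReal.ofReal_le_ofReal
        have hp : Real.pi ^ d ≠ 0 := by positivity
        have h1 : Real.exp (r ^ 2) * Real.pi ^ d * (Real.exp (-‖z‖ ^ 2) / Real.pi ^ d)
            = Real.exp (r ^ 2 + -‖z‖ ^ 2) := by
          rw [Real.exp_add]; field_simp
        rw [h1]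
        apply Real.one_le_exp
        nlinarith [norm_nonneg z]
    _ ≤ _ := lintegral_mono_set Set.inter_subset_left

/-- Point evaluations are bounded on the Fock space, uniformly on balls. -/
theorem Fock.exists_norm_apply_le (d : ℕ) (R : ℝ) :
    ∃ C : ℝ, 0 ≤ C ∧ ∀ (f : Fock d) (z : Cd d), ‖z‖ ≤ R → ‖f z‖ ≤ C * ‖f‖ := by
  obtain ⟨c, hc, hle⟩ := volume_restrict_ball_le d (R + 1)
  set ν : Measure (Cd d) := volume.restrict (ball 0 (R + 1)) with hν
  have hν' : ν Set.univ ≠ ∞ := by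
    rw [hν, Measure.restrict_apply_univ]; exact measure_ball_lt_top.ne
  set V := volume.real (ball (0 : Cd d) 1) with hV
  have hV0 : 0 < V := ENNReal.toReal_pos (measure_ball_pos _ _ one_pos).ne' measure_ball_lt_top.ne
  set D : ℝ≥0∞ := c ^ (1 / (2 : ℝ)) * ν Set.univ ^ (1 / (1 : ℝ) - 1 / (2 : ℝ)) with hD
  refine ⟨V⁻¹ * D.toReal, by positivity, fun f z hz => ?_⟩
  have hint : IntegrableOn (fun w => ‖f w‖) (ball (0 : Cd d) (R + 1)) :=
    (f.differentiable.continuous.norm.continuousOn.integrableOn_compact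
      (isCompact_closedBall 0 (R + 1))).mono_set ball_subset_closedBall
  have h1 : V * ‖f z‖ ≤ ∫ w in ball (0 : Cd d) (R + 1), ‖f w‖ := by
    calc V * ‖f z‖ = ‖∫ w in ball (0 : Cd d) 1, f (z + w)‖ := by
          rw [ball_mean_entire f.differentiable, norm_smul, Real.norm_of_nonneg hV0.le]
      _ ≤ ∫ w in ball (0 : Cd d) 1, ‖f (z + w)‖ := norm_integral_le_integral_norm _
      _ = ∫ w in ball z 1, ‖f w‖ := by
          have := (measurePreserving_add_left (volume : Measure (Cd d)) z).setIntegral_preimage_emb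
            (Homeomorph.addLeft z).measurableEmbedding (fun w => ‖f w‖) (ball z 1)
          rw [← this]
          congr 2
          ext w; simp
      _ ≤ ∫ w in ball (0 : Cd d) (R + 1), ‖f w‖ := by
          apply setIntegral_mono_set hint (Eventually.of_forall fun _ => norm_nonneg _)
          refine LE.le.eventuallyLE (ball_subset_ball' ?_)
          rw [dist_zero_right]; linarith
  have h2 : eLpNorm f 1 ν ≤ D * eLpNorm f 2 (fockMeasure d) := by
    calc eLpNorm f 1 ν ≤ eLpNorm f 2 ν * ν Set.univ ^ (1 / (1 : ℝ) - 1 / (2 : ℝ)) := by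
          simpa using eLpNorm_le_eLpNorm_mul_rpow_measure_univ (p := 1) (q := 2) (μ := ν)
            (by norm_num) f.differentiable.continuous.aestronglyMeasurable
      _ ≤ (c ^ (1 / (2 : ℝ)) * eLpNorm f 2 (fockMeasure d)) *
            ν Set.univ ^ (1 / (1 : ℝ) - 1 / (2 : ℝ)) := by
          gcongr
          refine (eLpNorm_mono_measure _ hle).trans ?_
          rw [eLpNorm_smul_measure_of_ne_top (by norm_num)]
          simp
      _ = _ := by rw [hD]; ring
  have hDtop : D ≠ ∞ := ENNReal.mul_ne_top (ENNReal.rpow_ne_top_of_nonneg (by norm_num) hc)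
    (ENNReal.rpow_ne_top_of_nonneg (by norm_num) hν')
  have h3 : ∫ w in ball (0 : Cd d) (R + 1), ‖f w‖ ≤ D.toReal * ‖f‖ := by
    rw [integral_norm_eq_lintegral_enorm f.differentiable.continuous.aestronglyMeasurable,
      ← eLpNorm_one_eq_lintegral_enorm, Fock.norm_eq, ← ENNReal.toReal_mul]
    exact ENNReal.toReal_mono (ENNReal.mul_ne_top hDtop f.memLp.2.ne) h2
  rw [mul_assoc, ← div_eq_inv_mul, le_div_iff₀ hV0, mul_comm]
  exact h1.trans h3

/-- Derivatives are bounded on the Fock space, uniformly on balls. -/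
theorem Fock.exists_norm_fderiv_le (d : ℕ) (R : ℝ) :
    ∃ C : ℝ, 0 ≤ C ∧ ∀ (f : Fock d) (z : Cd d), ‖z‖ ≤ R → ‖fderiv ℂ f z‖ ≤ C * ‖f‖ := by
  obtain ⟨C, hC, h⟩ := Fock.exists_norm_apply_le d (R + 1)
  refine ⟨C, hC, fun f z hz => ContinuousLinearMap.opNorm_le_of_unit_norm (by positivity) ?_⟩
  intro v hv
  have hf := f.differentiable
  have hd : HasDerivAt (fun t : ℂ => f (z + t • v)) (fderiv ℂ f z v) 0 := by
    have h1 : HasDerivAt (fun t : ℂ => z + t • v) v 0 := by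
      simpa using ((hasDerivAt_id (0 : ℂ)).smul_const v).const_add z
    have h2 : HasFDerivAt f (fderiv ℂ f z) (z + (0 : ℂ) • v) := by
      simpa using (hf z).hasFDerivAt
    exact h2.comp_hasDerivAt (0 : ℂ) h1
  rw [← hd.deriv]
  have := Complex.norm_deriv_le_of_forall_mem_sphere_norm_le (c := 0) (R := 1) (C := C * ‖f‖)
    (f := fun t : ℂ => f (z + t • v)) one_pos
    (Differentiable.diffContOnCl (by fun_prop : Differentiable ℂ fun t : ℂ => f (z + t • v)))
    (fun t ht => by
      apply h
      have ht' : ‖t‖ = 1 := by simpa using ht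
      calc ‖z + t • v‖ ≤ ‖z‖ + ‖t • v‖ := norm_add_le _ _
        _ ≤ R + 1 := by rw [norm_smul, ht', hv]; linarith)
  simpa using this

/-- The Fock space is a Hilbert space. -/
instance Fock.instCompleteSpace (d : ℕ) : CompleteSpace (Fock d) := by
  apply Metric.complete_of_cauchySeq_tendsto
  intro u hu
  have hpt : ∀ z, ∃ l, Tendsto (fun n => u n z) atTop (𝓝 l) := by
    intro z
    obtain ⟨C, hC, h⟩ := Fock.exists_norm_apply_le d ‖z‖
    apply cauchySeq_tendsto_of_complete
    rw [Metric.cauchySeq_iff] at hu ⊢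
    intro ε hε
    obtain ⟨N, hN⟩ := hu (ε / (C + 1)) (by positivity)
    refine ⟨N, fun m hm n hn => ?_⟩
    have h1 := hN m hm n hn
    rw [dist_eq_norm] at h1 ⊢
    rw [lt_div_iff₀ (by positivity)] at h1
    have h2 : ‖u m z - u n z‖ ≤ C * ‖u m - u n‖ := h (u m - u n) z le_rfl
    nlinarith [norm_nonneg (u m - u n)]
  choose F hF using hpt
  have huc : ∀ R : ℝ, UniformCauchySeqOn (fun n => fderiv ℂ (u n)) atTop (ball (0 : Cd d) R) := by
    intro R
    obtain ⟨C, hC, h⟩ := Fock.exists_norm_fderiv_le d R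
    rw [Metric.cauchySeq_iff] at hu
    rw [Metric.uniformCauchySeqOn_iff]
    intro ε hε
    obtain ⟨N, hN⟩ := hu (ε / (C + 1)) (by positivity)
    refine ⟨N, fun m hm n hn z hz => ?_⟩
    have h1 := hN m hm n hn
    rw [dist_eq_norm] at h1 ⊢
    rw [lt_div_iff₀ (by positivity)] at h1
    have h2 := h (u m - u n) z (by simpa using (mem_ball_zero_iff.1 hz).le)
    rw [Fock.coe_sub, fderiv_sub (u m).differentiable.differentiableAt
      (u n).differentiable.differentiableAt] at h2
    nlinarith [norm_nonneg (u m - u n)]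
  have hdpt : ∀ z, ∃ l, Tendsto (fun n => fderiv ℂ (u n) z) atTop (𝓝 l) := fun z =>
    cauchySeq_tendsto_of_complete ((huc (‖z‖ + 1)).cauchySeq (by simp))
  choose G hG using hdpt
  have hFd : Differentiable ℂ F := by
    intro z
    have := hasFDerivAt_of_tendstoUniformlyOn (x := z) (isOpen_ball (x := (0 : Cd d)) (ε := ‖z‖ + 1))
      ((huc (‖z‖ + 1)).tendstoUniformlyOn_of_tendsto fun w _ => hG w)
      (fun n w _ => ((u n).differentiable w).hasFDerivAt) (fun w _ => hF w) (by simp)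
    exact this.differentiableAt
  obtain ⟨g, hg⟩ := cauchySeq_tendsto_of_complete
    (Fock.toL2Isometry.isometry.uniformContinuous.comp_cauchySeq hu)
  have hgF : g =ᵐ[fockMeasure d] F := by
    obtain ⟨ns, hns, hae⟩ := (tendstoInMeasure_of_tendsto_Lp hg).exists_seq_tendsto_ae
    have hall : ∀ᵐ z ∂(fockMeasure d), ∀ n, Fock.toL2 (u n) z = u n z :=
      ae_all_iff.2 fun n => Fock.coeFn_toL2 (u n)
    filter_upwards [hae, hall] with z h1 h2
    refine tendsto_nhds_unique h1 (((hF z).comp hns.tendsto_atTop).congr fun n => ?_)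
    exact (h2 (ns n)).symm
  let F' : Fock d := Fock.mk F ⟨hFd, (memLp_congr_ae hgF).1 (Lp.memLp g)⟩
  refine ⟨F', ?_⟩
  have hF' : Fock.toL2Isometry F' = g := by
    apply Lp.ext
    exact (Fock.coeFn_toL2 F').trans hgF.symm
  rw [Fock.toL2Isometry.isometry.isEmbedding.tendsto_nhds_iff, hF']
  exact hg

/-- The kernel function `K_z(u) = e^{⟨u, z⟩}` belongs to the Fock space. -/
theorem kernel_mem (d : ℕ) (z : Cd d) :
    (fun u : Cd d => Complex.exp (inner ℂ z u)) ∈ fockSubmodule d := by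
  have hd : Differentiable ℂ (fun u : Cd d => Complex.exp (inner ℂ z u)) :=
    (innerSL ℂ z).differentiable.cexp
  refine ⟨hd, ?_⟩
  rw [memLp_two_iff_integrable_sq_norm hd.continuous.aestronglyMeasurable, fockMeasure,
    integrable_withDensity_iff_integrable_smul' (fockDensity_measurable d)
      (Eventually.of_forall fun _ => ENNReal.ofReal_lt_top)]
  have h := ((GaussianFourier.integrable_cexp_neg_mul_sq_norm_add (b := 1) (by simp) 2 z).norm).div_const
    (Real.pi ^ d)
  refine h.congr (Eventually.of_forall fun u => ?_)
  have hin : (inner ℝ z u : ℝ) = (inner ℂ z u).re := by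
    simp [PiLp.inner_apply, Complex.inner, Complex.mul_re]
  simp only [smul_eq_mul]
  rw [ENNReal.toReal_ofReal (fockDensity_pos u).le, Complex.norm_exp, Complex.norm_exp, hin,
    ← Real.exp_nat_mul, div_mul_eq_mul_div, ← Real.exp_add]
  congr 2
  simp [← Complex.ofReal_pow]

/-- The kernel function `K_z(u) = e^{⟨u, z⟩}`, with `⟨u, z⟩ = ∑ j, u j * conj (z j)`. -/
def fockKernel {d : ℕ} (z : Cd d) : Fock d :=
  Fock.mk (fun u => Complex.exp (inner ℂ z u)) (kernel_mem d z)

/-- The maximal weighted composition operator `f ↦ ψ · (f ∘ φ)` on the Fock space, with domain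
all `f` in the Fock space such that `ψ · (f ∘ φ)` is in the Fock space. -/
def maxWCO {d : ℕ} (ψ : Cd d → ℂ) (φ : Cd d → Cd d) : Fock d →ₗ.[ℂ] Fock d where
  domain :=
    { carrier := {f | (fun z => ψ z * f (φ z)) ∈ fockSubmodule d}
      zero_mem' := by
        have : (fun z => ψ z * (0 : Fock d) (φ z)) = 0 := by ext; simp
        simp only [Set.mem_ofPred_eq, this, Submodule.zero_mem]
      add_mem' := fun {f g} hf hg => by
        have : (fun z => ψ z * (f + g) (φ z))
            = (fun z => ψ z * f (φ z)) + fun z => ψ z * g (φ z) := by ext; simp [mul_add]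
        simp only [Set.mem_ofPred_eq, this]
        exact Submodule.add_mem _ hf hg
      smul_mem' := fun c f hf => by
        have : (fun z => ψ z * (c • f) (φ z)) = c • fun z => ψ z * f (φ z) := by
          ext; simp [mul_left_comm]
        simp only [Set.mem_ofPred_eq, this]
        exact Submodule.smul_mem _ c hf }
  toFun :=
    { toFun := fun f => Fock.mk (fun z => ψ z * f.1 (φ z)) f.2
      map_add' := fun f g => by
        apply DFunLike.coe_injective; ext; simp [mul_add]
      map_smul' := fun c f => by
        apply DFunLike.coe_injective; ext; simp [mul_left_comm] }

end

/-! Pairing the operator with kernel functions decides the symbols. With ε = 1 or ε = -1, symmetry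
up to ε on kernels reads conj ψ(w) · e^{⟨z, φ(w)⟩} = ε ψ(z) e^{⟨φ(z), w⟩}. Setting w = 0 determines
ψ; comparing exponents then shows that φ - φ(0) is symmetric for the inner product, hence linear
(`exists_affine_of_inner_fockKernel`).

Conversely, for symbols of this form the reproducing property gives T* ⊆ εT at once. The hard
inclusion is that T is symmetric up to ε on its whole maximal domain, not only on the span of the
kernels. For θ = 1, T is closed and symmetric against that span, so by the von Neumann type argument
of `LinearPMap.isFormalAdjoint_self_of_deficiency_eq_zero` it is enough that e^{⟨w, q⟩} f(Aw + q) =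
l f(w) has no nonzero solution in the Fock space for non-real l (`eq_zero_of_shift_eigenvalue`).

To see this, split q = (b - Ab) + q₁ with Aq₁ = q₁; a Weyl translation by b reduces to q = q₁. On
the line ℂq, multiplication by a Gaussian factor turns the equation into g(x + 1) = c g(x) with c
non-real and g bounded on a strip, so Liouville's theorem gives g = 0. Derivatives of f along
eigenvectors of A orthogonal to q satisfy an equation of the same kind, so they vanish on ℂq too,
and Taylor expansion off the line gives f = 0. -/

/-! ### Vanishing criteria for entire functions of one variable -/

/-- An entire function that is bounded on a vertical strip of width one and is multiplied by a
non-real constant under translation by one vanishes. -/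
theorem eq_zero_of_quasiperiodic {h : ℂ → ℂ} (hh : Differentiable ℂ h) {c : ℂ} (hc : c.im ≠ 0)
    (hper : ∀ x, h (x + 1) = c * h x) {B : ℝ}
    (hB : ∀ x : ℂ, 0 ≤ x.re → x.re ≤ 1 → ‖h x‖ ≤ B) : h = 0 := by
  have hc0 : c ≠ 0 := by rintro rfl; simp at hc
  have hcn : (0 : ℝ) < ‖c‖ := norm_pos_iff.2 hc0
  have hcC : (‖c‖ : ℂ) ≠ 0 := by exact_mod_cast hcn.ne'
  -- The factor ‖c‖^{-x} makes the multiplier unimodular, so |k| has period one and the strip bound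
  -- becomes global.
  set k : ℂ → ℂ := fun x => h x * Complex.exp (-(Real.log ‖c‖ : ℝ) * x) with hk
  have hkd : Differentiable ℂ k := by fun_prop
  have hkper : ∀ x, k (x + 1) = (c / ‖c‖) * k x := by
    intro x
    simp only [hk, hper]
    rw [mul_add, Complex.exp_add, mul_one, Complex.exp_neg (Real.log ‖c‖ : ℂ),
      ← Complex.ofReal_exp, Real.exp_log hcn]
    field_simp
  have hnper : Function.Periodic (fun x => ‖k x‖) 1 := by
    intro x
    simp only [hkper, norm_mul, norm_div, Complex.norm_real, norm_norm]
    rw [div_self hcn.ne', one_mul]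
  have hbound : ∀ x, ‖k x‖ ≤ B * Real.exp |Real.log ‖c‖| := by
    intro x
    have h1 : ‖k (x - (⌊x.re⌋ : ℂ))‖ = ‖k x‖ := by
      simpa using hnper.sub_zsmul_eq (x := x) ⌊x.re⌋
    rw [← h1]
    set y := x - (⌊x.re⌋ : ℂ) with hy
    have hyre : y.re = Int.fract x.re := by simp [hy]
    have h0 : 0 ≤ y.re := hyre ▸ Int.fract_nonneg _
    have h2 : y.re ≤ 1 := hyre ▸ (Int.fract_lt_one _).le
    have hB0 : 0 ≤ B := (norm_nonneg _).trans (hB y h0 h2)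
    simp only [hk, norm_mul, Complex.norm_exp]
    refine mul_le_mul (hB y h0 h2) (Real.exp_le_exp.2 ?_) (Real.exp_pos _).le hB0
    have h3 : (-(Real.log ‖c‖ : ℂ) * y).re = -(Real.log ‖c‖) * y.re := by simp
    rw [h3]
    calc -(Real.log ‖c‖) * y.re ≤ |-(Real.log ‖c‖) * y.re| := le_abs_self _
      _ = |Real.log ‖c‖| * y.re := by rw [abs_mul, abs_neg, abs_of_nonneg h0]
      _ ≤ _ := mul_le_of_le_one_right (abs_nonneg _) h2
  have hconst : ∀ x y, k x = k y := hkd.apply_eq_apply_of_bounded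
    (isBounded_iff_forall_norm_le.2 ⟨_, by rintro _ ⟨x, rfl⟩; exact hbound x⟩)
  have hk0 : ∀ x, k x = 0 := by
    intro x
    have h1 := hkper x
    rw [hconst (x + 1) x] at h1
    -- By Liouville k is constant; a nonzero constant would force c = ‖c‖, which is real.
    by_contra hne
    have h2 : c / ‖c‖ = 1 := (mul_right_cancel₀ hne (by rw [← h1, one_mul]))
    rw [div_eq_one_iff_eq hcC] at h2
    exact hc (by rw [h2]; simp)
  funext x
  simpa [hk] using hk0 x

/-- An entire function of one variable all of whose derivatives vanish at the origin is zero. -/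
theorem eq_zero_of_iteratedDeriv_eq_zero {g : ℂ → ℂ} (hg : Differentiable ℂ g)
    (h : ∀ n, iteratedDeriv n g 0 = 0) (t : ℂ) : g t = 0 := by
  rw [← Complex.taylorSeries_eq_of_entire' (c := 0) t hg]
  simp [h]

/-! ### Directional derivatives of entire functions -/

section DirectionalDerivative

variable {E : Type*} [NormedAddCommGroup E] [NormedSpace ℂ E]

theorem hasDerivAt_comp_line {f : E → ℂ} (hf : Differentiable ℂ f) (z v : E) (t : ℂ) :
    HasDerivAt (fun t : ℂ => f (z + t • v)) (fderiv ℂ f (z + t • v) v) t := by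
  have h1 : HasDerivAt (fun t : ℂ => z + t • v) v t := by
    simpa using ((hasDerivAt_id t).smul_const v).const_add z
  exact (hf (z + t • v)).hasFDerivAt.comp_hasDerivAt t h1

theorem norm_fderiv_apply_le_of_forall_sphere {f : E → ℂ} (hf : Differentiable ℂ f) (z v : E)
    {B : ℝ} (hB : ∀ t : ℂ, ‖t‖ = 1 → ‖f (z + t • v)‖ ≤ B) : ‖fderiv ℂ f z v‖ ≤ B := by
  have hd := hasDerivAt_comp_line hf z v 0
  rw [zero_smul, add_zero] at hd
  rw [← hd.deriv]
  simpa using Complex.norm_deriv_le_of_forall_mem_sphere_norm_le (c := 0) (R := 1) (C := B)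
    (f := fun t : ℂ => f (z + t • v)) one_pos
    (Differentiable.diffContOnCl (by fun_prop : Differentiable ℂ fun t : ℂ => f (z + t • v)))
    (fun t ht => hB t (by simpa using ht))

/-- The derivative of an entire function is locally bounded. -/
theorem exists_norm_fderiv_le [FiniteDimensional ℂ E] {f : E → ℂ} (hf : Differentiable ℂ f)
    (R : ℝ) : ∃ B : ℝ, ∀ z, ‖z‖ ≤ R → ‖fderiv ℂ f z‖ ≤ B := by
  have : ProperSpace E := FiniteDimensional.proper ℂ E
  obtain ⟨B, hB⟩ := (isCompact_closedBall (0 : E) (R + 1)).exists_bound_of_continuousOn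
    hf.continuous.continuousOn
  refine ⟨max B 0, fun z hz => ContinuousLinearMap.opNorm_le_of_unit_norm (le_max_right _ _) ?_⟩
  intro v hv
  refine (norm_fderiv_apply_le_of_forall_sphere hf z v fun t ht => hB _ ?_).trans (le_max_left _ _)
  rw [mem_closedBall_zero_iff]
  refine (norm_add_le _ _).trans ?_
  rw [norm_smul, ht, hv]; linarith

/-- Directional derivatives of entire functions are entire. -/
theorem differentiable_fderiv_apply [FiniteDimensional ℂ E] {f : E → ℂ} (hf : Differentiable ℂ f)
    (v : E) : Differentiable ℂ fun z => fderiv ℂ f z v := by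
  -- Cauchy's formula for the derivative, to be differentiated under the integral: on the unit
  -- circle dt / t² equals (i / t) dθ.
  set a : ℝ → ℂ := fun θ => Complex.I * (circleMap 0 1 θ)⁻¹ with ha
  have hcm0 : ∀ θ : ℝ, circleMap 0 1 θ ≠ 0 := fun θ => circleMap_ne_center one_ne_zero
  have hac : Continuous a := continuous_const.mul ((continuous_circleMap 0 1).inv₀ hcm0)
  have hcauchy : (fun z => fderiv ℂ f z v) = fun z => (2 * Real.pi * Complex.I : ℂ)⁻¹ *
      ∫ θ in (0 : ℝ)..2 * Real.pi, a θ * f (z + circleMap 0 1 θ • v) := by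
    funext z
    have hd := hasDerivAt_comp_line hf z v 0
    rw [zero_smul, add_zero] at hd
    have h1 := (DiffContOnCl.deriv_eq_smul_circleIntegral (c := 0) (R := 1) one_pos
      (Differentiable.diffContOnCl
        (by fun_prop : Differentiable ℂ fun t : ℂ => f (z + t • v))))
    rw [hd.deriv, circleIntegral, smul_eq_mul] at h1
    rw [← div_eq_inv_mul, eq_div_iff Complex.two_pi_I_ne_zero, mul_comm, ← h1]
    congr 1
    funext θ
    have := hcm0 θ
    simp only [deriv_circleMap, smul_eq_mul, ha, sub_zero]
    field_simp
  rw [hcauchy]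
  refine Differentiable.const_mul (fun z₀ => ?_) _
  obtain ⟨B, hB⟩ := exists_norm_fderiv_le hf (‖z₀‖ + 1 + ‖v‖)
  have hcont : ∀ z : E, Continuous fun θ : ℝ => a θ * f (z + circleMap 0 1 θ • v) := by
    intro z
    have := hf.continuous
    have h3 := continuous_circleMap 0 1
    fun_prop
  have hna : ∀ θ, ‖a θ‖ = 1 := fun θ => by simp [ha]
  have hmeas : StronglyMeasurable fun θ : ℝ =>
      a θ • fderiv ℂ f (z₀ + circleMap 0 1 θ • v) := by
    borelize E
    have h3 := continuous_circleMap 0 1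
    have h4 : Continuous fun θ : ℝ => z₀ + circleMap 0 1 θ • v := by fun_prop
    have h5 := (measurable_fderiv ℂ f).comp h4.measurable
    exact hac.stronglyMeasurable.smul h5.stronglyMeasurable
  refine (intervalIntegral.hasFDerivAt_integral_of_dominated_of_fderiv_le (μ := volume)
    (F := fun z θ => a θ * f (z + circleMap 0 1 θ • v))
    (F' := fun z θ => a θ • fderiv ℂ f (z + circleMap 0 1 θ • v)) (bound := fun _ => B)
    (ball_mem_nhds z₀ one_pos) (Eventually.of_forall fun z => (hcont z).aestronglyMeasurable)
    ((hcont z₀).intervalIntegrable _ _) hmeas.aestronglyMeasurable ?_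
    intervalIntegrable_const ?_).differentiableAt
  · refine Eventually.of_forall fun θ _ z hz => ?_
    rw [norm_smul, hna, one_mul]
    apply hB
    have h6 : ‖z‖ ≤ ‖z₀‖ + 1 := by
      have := norm_le_norm_add_norm_sub z₀ z
      rw [mem_ball, dist_eq_norm] at hz
      rw [norm_sub_rev] at hz
      linarith
    calc _ ≤ ‖z‖ + ‖circleMap 0 1 θ • v‖ := norm_add_le _ _
      _ ≤ _ := by rw [norm_smul]; simpa using h6
  · refine Eventually.of_forall fun θ _ z _ => ?_
    have h7 : HasFDerivAt (fun z : E => f (z + circleMap 0 1 θ • v))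
        (fderiv ℂ f (z + circleMap 0 1 θ • v)) z :=
      (hasFDerivAt_comp_add_right _).2 (hf _).hasFDerivAt
    exact h7.const_mul (a θ)

theorem iteratedDeriv_comp_line [FiniteDimensional ℂ E] {f : E → ℂ} (hf : Differentiable ℂ f)
    (z v : E) (n : ℕ) (t : ℂ) :
    iteratedDeriv n (fun t : ℂ => f (z + t • v)) t
      = (fun g : E → ℂ => fun w => fderiv ℂ g w v)^[n] f (z + t • v) := by
  induction n generalizing f with
  | zero => simp
  | succ n ih =>
    rw [iteratedDeriv_succ', Function.iterate_succ_apply]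
    rw [← ih (differentiable_fderiv_apply hf v)]
    congr 1
    funext t
    exact (hasDerivAt_comp_line hf z v t).deriv

end DirectionalDerivative

/-! ### The eigenvalue equation for an affine shift -/

section EigenvalueEquation

variable {E : Type*} [NormedAddCommGroup E] [InnerProductSpace ℂ E]

/-- Entire functions that grow at most like `e^{|z|²/2}` near the line `ℂ q` and solve the
eigenvalue equation `e^{⟨w, q⟩} f(A w + q) = l f(w)` for some non-real `l`. -/
structure IsShiftEigenfunction (A : E →ₗ[ℂ] E) (q : E) (f : E → ℂ) : Prop where
  differentiable : Differentiable ℂ f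
  growth : ∀ R : ℝ, ∃ C : ℝ, ∀ (x : ℂ) (u : E), inner ℂ q u = 0 → ‖u‖ ≤ R →
    ‖f (x • q + u)‖ ≤ C * Real.exp (‖x • q‖ ^ 2 / 2)
  eigen : ∃ l : ℂ, l.im ≠ 0 ∧ ∀ w, Complex.exp (inner ℂ q w) * f (A w + q) = l * f w

namespace IsShiftEigenfunction

variable {A : E →ₗ[ℂ] E} {q : E} {f : E → ℂ}

theorem zero : IsShiftEigenfunction A q (fun _ => 0) where
  differentiable := differentiable_const 0
  growth _ := ⟨0, by simp⟩
  eigen := ⟨Complex.I, by simp, by simp⟩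

/-- The weight e^{⟨w, q⟩} is constant along v, so differentiating the equation only produces the
factor m, and l / m stays non-real because m is real. The growth condition survives since Cauchy
estimates along v move only the component orthogonal to q, at the cost of enlarging R by ‖v‖. -/
theorem fderiv_apply [FiniteDimensional ℂ E] (h : IsShiftEigenfunction A q f) {v : E}
    (hqv : inner ℂ q v = 0) {m : ℝ} (hv : A v = (m : ℂ) • v) :
    IsShiftEigenfunction A q (fun w => fderiv ℂ f w v) := by
  obtain ⟨l, hl, he⟩ := h.eigen
  have hl0 : l ≠ 0 := by rintro rfl; simp at hl
  have hd : ∀ w, (m : ℂ) * (Complex.exp (inner ℂ q w) * fderiv ℂ f (A w + q) v)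
      = l * fderiv ℂ f w v := by
    intro w
    have h1 := (hasDerivAt_comp_line h.differentiable w v 0).const_mul l
    have h2 := ((hasDerivAt_comp_line h.differentiable (A w + q) ((m : ℂ) • v) 0).const_mul
      (Complex.exp (inner ℂ q w)))
    have h3 : (fun t : ℂ => l * f (w + t • v)) =
        fun t : ℂ => Complex.exp (inner ℂ q w) * f (A w + q + t • (m : ℂ) • v) := by
      funext t
      rw [← he, inner_add_right, inner_smul_right, hqv, mul_zero, add_zero, map_add, map_smul, hv]
      congr 2
      abel
    rw [h3] at h1
    have h4 := h2.unique h1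
    rw [zero_smul, zero_smul, add_zero, add_zero, map_smul, smul_eq_mul] at h4
    rw [← h4]; ring
  -- If A kills v, the differentiated equation says l ∂ᵥf = 0.
  by_cases hm : m = 0
  · have : (fun w => fderiv ℂ f w v) = fun _ => 0 := by
      funext w
      have := hd w
      simpa [hm, hl0] using this.symm
    rw [this]
    exact zero
  · have hm' : (m : ℂ) ≠ 0 := by exact_mod_cast hm
    refine ⟨differentiable_fderiv_apply h.differentiable v, fun R => ?_, l / m, ?_, fun w => ?_⟩
    · obtain ⟨C, hC⟩ := h.growth (R + ‖v‖)
      refine ⟨C, fun x u hu huR => ?_⟩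
      refine norm_fderiv_apply_le_of_forall_sphere h.differentiable _ _ fun t ht => ?_
      rw [add_assoc]
      refine hC x _ (by rw [inner_add_right, inner_smul_right, hu, hqv]; simp) ?_
      refine (norm_add_le _ _).trans ?_
      rw [norm_smul, ht]; linarith
    · rw [Complex.div_ofReal_im]
      exact div_ne_zero hl hm
    · rw [div_mul_eq_mul_div, eq_div_iff hm', ← hd w]; ring

/-- With r = ‖q‖², the factor e^{r x² / 2} absorbs the weight e^{r x} under x ↦ x + 1, leaving the
constant multiplier e^{r / 2} l. It also cancels the growth in Im x: the two exponents add up to r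
(Re x)², at most r on the strip. -/
theorem apply_smul_eq_zero (h : IsShiftEigenfunction A q f) (hq : A q = q) (x : ℂ) :
    f (x • q) = 0 := by
  obtain ⟨l, hl, he⟩ := h.eigen
  obtain ⟨C, hC⟩ := h.growth 0
  have hd := h.differentiable
  set r : ℝ := ‖q‖ ^ 2 with hr
  set g : ℂ → ℂ := fun x => Complex.exp (r / 2 * x ^ 2) * f (x • q) with hg
  have hC0 : 0 ≤ C := by
    have := (norm_nonneg _).trans (hC 0 0 (by simp) (by simp))
    simpa using this
  have hqq : inner ℂ q q = (r : ℂ) := by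
    rw [inner_self_eq_norm_sq_to_K, hr]; push_cast; rfl
  have : g = 0 := by
    refine eq_zero_of_quasiperiodic (c := Real.exp (r / 2) * l) (B := C * Real.exp r)
      (by fun_prop) ?_ ?_ ?_
    · rw [Complex.im_ofReal_mul]
      exact mul_ne_zero (Real.exp_pos _).ne' hl
    · intro x
      have h1 := he (x • q)
      rw [map_smul, hq, inner_smul_right, hqq] at h1
      have h2 : (x + 1) • q = x • q + q := by rw [add_smul, one_smul]
      simp only [hg, h2]
      rw [show (r / 2 * (x + 1) ^ 2 : ℂ) = r / 2 + r / 2 * x ^ 2 + x * r by ring, Complex.exp_add,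
        Complex.exp_add, mul_assoc, h1]
      push_cast
      ring
    · intro x h0 h1
      have h2 := hC x 0 (by simp) (by simp)
      rw [add_zero] at h2
      simp only [hg, norm_mul, Complex.norm_exp]
      refine (mul_le_mul_of_nonneg_left h2 (Real.exp_pos _).le).trans ?_
      rw [mul_left_comm, ← Real.exp_add]
      refine mul_le_mul_of_nonneg_left (Real.exp_le_exp.2 ?_) hC0
      have h3 : (r / 2 * x ^ 2 : ℂ).re = r / 2 * (x.re ^ 2 - x.im ^ 2) := by
        have : (r / 2 * x ^ 2 : ℂ) = ((r / 2 : ℝ) : ℂ) * x ^ 2 := by push_cast; rfl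
        rw [this, Complex.re_ofReal_mul, pow_two, Complex.mul_re]; ring
      have h4 : ‖x • q‖ ^ 2 = r * (x.re ^ 2 + x.im ^ 2) := by
        rw [norm_smul, mul_pow, ← hr, Complex.sq_norm, Complex.normSq_apply]; ring
      rw [h3, h4]
      have hr0 : 0 ≤ r := by positivity
      have : x.re ^ 2 ≤ 1 := by nlinarith
      nlinarith
  have h5 := congrFun this x
  simpa [hg] using h5

/-- Induction on the number of directions, for all f at once: the Taylor coefficients along a new
direction are values of iterated derivatives of f, which lie in the same class, at points using
fewer directions. -/
theorem apply_add_sum_eq_zero [FiniteDimensional ℂ E] (hq : A q = q) {ι : Type*} {v : ι → E}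
    {m : ι → ℝ} (hqv : ∀ i, inner ℂ q (v i) = 0) (hv : ∀ i, A (v i) = (m i : ℂ) • v i)
    (s : Finset ι) (c : ι → ℂ) (x : ℂ) (h : IsShiftEigenfunction A q f) :
    f (x • q + ∑ i ∈ s, c i • v i) = 0 := by
  classical
  induction s using Finset.induction_on generalizing f with
  | empty => simpa using h.apply_smul_eq_zero hq x
  | insert i s hi ih =>
    rw [Finset.sum_insert hi, add_left_comm, add_comm]
    have hd := h.differentiable
    refine eq_zero_of_iteratedDeriv_eq_zero
      (g := fun t : ℂ => f (x • q + ∑ i ∈ s, c i • v i + t • v i)) (by fun_prop) (fun n => ?_) (c i)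
    rw [iteratedDeriv_comp_line hd, zero_smul, add_zero]
    apply ih
    clear hd ih
    induction n generalizing f with
    | zero => exact h
    | succ n ih => exact ih (h.fderiv_apply (hqv i) (hv i))

/-- Projecting an eigenbasis of A onto the orthogonal complement of q keeps eigenvectors, because q
is itself fixed by the symmetric map A. Together with q these projections span E. -/
theorem eq_zero [FiniteDimensional ℂ E] (hA : A.IsSymmetric) (hq : A q = q)
    (h : IsShiftEigenfunction A q f) : f = 0 := by
  funext z
  set b := hA.eigenvectorBasis rfl with hb
  set m := hA.eigenvalues rfl with hm
  -- The coefficient of the projection onto ℂq. For q = 0 the quotient is 0 / 0 = 0, so `v` is then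
  -- the eigenbasis itself.
  set y : E → ℂ := fun u => inner ℂ q u / inner ℂ q q with hy
  set v := fun i => b i - y (b i) • q with hv
  have hAb : ∀ i, A (b i) = (m i : ℂ) • b i := fun i => hA.apply_eigenvectorBasis rfl i
  have hqv : ∀ i, inner ℂ q (v i) = 0 := by
    intro i
    simp only [hv, hy, inner_sub_right, inner_smul_right]
    by_cases hq0 : q = 0
    · simp [hq0]
    · rw [div_mul_cancel₀ _ (inner_self_ne_zero.2 hq0), sub_self]
  have hAv : ∀ i, A (v i) = (m i : ℂ) • v i := by
    intro i
    simp only [hv, map_sub, map_smul, hq, hAb, smul_sub]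
    congr 1
    -- Either `b i` is orthogonal to q or its eigenvalue is 1.
    have h1 : (m i : ℂ) * inner ℂ q (b i) = inner ℂ q (b i) := by
      rw [← inner_smul_right, ← hAb, ← hA, hq]
    rw [smul_smul]
    simp only [hy]
    rw [← mul_div_assoc, h1]
  have hz : z = (∑ i, inner ℂ (b i) z * y (b i)) • q + ∑ i, inner ℂ (b i) z • v i := by
    simp only [hv, smul_sub, Finset.sum_sub_distrib, Finset.sum_smul, smul_smul]
    rw [b.sum_repr' z]
    abel
  rw [hz]
  exact apply_add_sum_eq_zero hq hqv hAv _ _ _ h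

end IsShiftEigenfunction

/-- The operator `f ↦ e^{⟨·, q⟩} f(A · + q)` with symmetric `A` has no non-real eigenvalue with an
eigenfunction that grows at most like `e^{|z|²/2}`. -/
theorem eq_zero_of_shift_eigenvalue [FiniteDimensional ℂ E] {A : E →ₗ[ℂ] E} (hA : A.IsSymmetric)
    {q : E} {f : E → ℂ} (hf : Differentiable ℂ f) {C : ℝ}
    (hC : ∀ z, ‖f z‖ ≤ C * Real.exp (‖z‖ ^ 2 / 2)) {l : ℂ} (hl : l.im ≠ 0)
    (he : ∀ w, Complex.exp (inner ℂ q w) * f (A w + q) = l * f w) : f = 0 := by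
  have hT : (LinearMap.id - A).IsSymmetric := LinearMap.IsSymmetric.id.sub hA
  -- For symmetric A, the orthogonal complement of the range of 1 - A is its kernel, the fixed space
  -- of A.
  obtain ⟨b', ⟨b, rfl⟩, q₁, hq₁, hqb⟩ :=
    (LinearMap.range (LinearMap.id - A)).exists_add_mem_mem_orthogonal q
  have hAq₁ : A q₁ = q₁ := by
    rw [hT.orthogonal_range, LinearMap.mem_ker, LinearMap.sub_apply, LinearMap.id_apply,
      sub_eq_zero] at hq₁
    exact hq₁.symm
  have hAb : A b + q = b + q₁ := by
    rw [hqb, LinearMap.sub_apply, LinearMap.id_apply]; abel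
  have hC0 : 0 ≤ C := by simpa using (norm_nonneg _).trans (hC 0)
  -- The Weyl translation preserves the growth e^{|w|² / 2}: its exponential factor cancels the
  -- cross term of |w + b|².
  have hnorm : ∀ w, ‖Complex.exp (-inner ℂ b w) * f (w + b)‖
      ≤ C * Real.exp (‖b‖ ^ 2 / 2) * Real.exp (‖w‖ ^ 2 / 2) := by
    intro w
    rw [norm_mul, Complex.norm_exp, mul_assoc, ← Real.exp_add]
    refine (mul_le_mul_of_nonneg_left (hC (w + b)) (Real.exp_pos _).le).trans (le_of_eq ?_)
    have h1 : (inner ℂ w b : ℂ).re = (inner ℂ b w : ℂ).re := inner_re_symm (𝕜 := ℂ) w b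
    rw [mul_left_comm, ← Real.exp_add, @norm_add_sq ℂ]
    simp only [Complex.neg_re, RCLike.re_eq_complex_re, h1]
    congr 2
    ring
  have hkey : IsShiftEigenfunction A q₁ (fun w => Complex.exp (-inner ℂ b w) * f (w + b)) := by
    refine ⟨?_, fun R => ⟨C * Real.exp (‖b‖ ^ 2 / 2) * Real.exp (R ^ 2 / 2), ?_⟩,
      Complex.exp (-(inner ℂ q b + inner ℂ b q₁)) * l, ?_, fun w => ?_⟩
    · have : Differentiable ℂ fun w => inner ℂ b w := (innerSL ℂ b).differentiable
      fun_prop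
    · intro x u hu huR
      refine (hnorm _).trans ?_
      rw [mul_assoc _ (Real.exp (R ^ 2 / 2)), ← Real.exp_add]
      refine mul_le_mul_of_nonneg_left (Real.exp_le_exp.2 ?_) (by positivity)
      rw [@norm_add_sq ℂ, inner_smul_left, hu]
      have : ‖u‖ ^ 2 ≤ R ^ 2 := pow_le_pow_left₀ (norm_nonneg u) huR 2
      simp
      linarith
    · have hre : (inner ℂ q b + inner ℂ b q₁ : ℂ).im = 0 := by
        have h1 : (inner ℂ q b + inner ℂ b q₁ : ℂ)
            = inner ℂ b b - inner ℂ (A b) b + (inner ℂ q₁ b + conj (inner ℂ q₁ b)) := by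
          have : q = b + q₁ - A b := by rw [← hAb]; abel
          rw [inner_conj_symm, this, inner_sub_left, inner_add_left]
          ring
        have h2 : (inner ℂ b b : ℂ).im = 0 := inner_self_im (𝕜 := ℂ) b
        have h3 : (inner ℂ (A b) b : ℂ).im = 0 := hA.im_inner_apply_self b
        rw [h1, Complex.add_im, Complex.sub_im, h2, h3, Complex.add_im, Complex.conj_im]
        ring
      have h2 : (-(inner ℂ q b + inner ℂ b q₁) : ℂ)
          = (((-(inner ℂ q b + inner ℂ b q₁) : ℂ).re : ℝ) : ℂ) := by
        apply Complex.ext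
        · simp
        · rw [Complex.neg_im, hre, Complex.ofReal_im, neg_zero]
      rw [h2, ← Complex.ofReal_exp, Complex.im_ofReal_mul]
      exact mul_ne_zero (Real.exp_pos _).ne' hl
    · have h1 := he (w + b)
      rw [map_add, add_assoc, hAb, inner_add_right] at h1
      have h2 : A w + q₁ + b = A w + (b + q₁) := by abel
      rw [h2]
      have h3 : inner ℂ q₁ w - inner ℂ b (A w) = inner ℂ q w - (inner ℂ b w : ℂ) := by
        rw [← hA, ← inner_sub_left, ← inner_sub_left]
        congr 1
        rw [sub_eq_sub_iff_add_eq_add, add_comm q₁, ← hAb]; abel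
      have h4 : Complex.exp (inner ℂ q₁ w) * (Complex.exp (-inner ℂ b (A w + q₁)))
          = Complex.exp (-(inner ℂ q b + inner ℂ b q₁)) * Complex.exp (-inner ℂ b w) *
            Complex.exp (inner ℂ q w + inner ℂ q b) := by
        rw [← Complex.exp_add, ← Complex.exp_add, ← Complex.exp_add, inner_add_right]
        congr 1
        linear_combination h3
      rw [← mul_assoc, h4, mul_assoc, h1]
      ring
  have hz := hkey.eq_zero hA hAq₁
  funext z
  have := congrFun hz (z - b)
  simpa using this

end EigenvalueEquation

/-! ### The Gaussian measure and the reproducing kernel -/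

theorem integral_fockMeasure {d : ℕ} (g : Cd d → ℂ) :
    ∫ z, g z ∂(fockMeasure d) = ∫ z, (Real.exp (-‖z‖ ^ 2) / Real.pi ^ d : ℝ) • g z := by
  rw [fockMeasure, integral_withDensity_eq_integral_toReal_smul (fockDensity_measurable d)
    (Eventually.of_forall fun _ => ENNReal.ofReal_lt_top)]
  simp only [ENNReal.toReal_ofReal (fockDensity_pos _).le]

theorem integrable_fockMeasure_iff {d : ℕ} (g : Cd d → ℂ) :
    Integrable g (fockMeasure d) ↔
      Integrable fun z => (Real.exp (-‖z‖ ^ 2) / Real.pi ^ d : ℝ) • g z := by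
  rw [fockMeasure, integrable_withDensity_iff_integrable_smul' (fockDensity_measurable d)
      (Eventually.of_forall fun _ => ENNReal.ofReal_lt_top)]
  simp only [ENNReal.toReal_ofReal (fockDensity_pos _).le]

instance isProbabilityMeasure_fockMeasure (d : ℕ) : IsProbabilityMeasure (fockMeasure d) := by
  have h := GaussianFourier.integral_rexp_neg_mul_sq_norm (V := Cd d) (b := 1) one_pos
  have hfin : Module.finrank ℝ (Cd d) = 2 * d := by
    rw [finrank_real_of_complex, finrank_euclideanSpace_fin]
  have hpi : Real.pi ^ d ≠ 0 := by positivity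
  rw [hfin, div_one, Nat.cast_mul, Nat.cast_ofNat, mul_div_cancel_left₀ _ two_ne_zero,
    Real.rpow_natCast] at h
  -- A nonzero Bochner integral forces integrability.
  have hi := not_imp_comm.1 integral_undef (h.trans_ne hpi)
  simp only [neg_one_mul] at h hi
  constructor
  rw [fockMeasure, withDensity_apply _ MeasurableSet.univ, Measure.restrict_univ,
    ← ofReal_integral_eq_lintegral_ofReal (hi.div_const _)
      (Eventually.of_forall fun z => (fockDensity_pos z).le), integral_div, h, div_self hpi,
    ENNReal.ofReal_one]

/-- Multiplication by a complex number of modulus one preserves the Gaussian measure. -/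
theorem measurePreserving_smul_fockMeasure (d : ℕ) (c : ℂ) (hc : ‖c‖ = 1) :
    MeasurePreserving (fun w : Cd d => c • w) (fockMeasure d) (fockMeasure d) := by
  have hc0 : c ≠ 0 := by rintro rfl; simp at hc
  let e : Cd d ≃ₗᵢ[ℝ] Cd d :=
    { toLinearEquiv := (LinearEquiv.smulOfNeZero ℂ (Cd d) c hc0).restrictScalars ℝ
      norm_map' := fun x => by
        change ‖c • x‖ = ‖x‖
        rw [norm_smul, hc, one_mul] }
  have hm : Measurable fun w : Cd d => c • w := measurable_const_smul c
  refine ⟨hm, Measure.ext fun s hs => ?_⟩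
  have h := e.measurePreserving.setLIntegral_comp_preimage_emb e.toHomeomorph.measurableEmbedding
    (fun w => ENNReal.ofReal (Real.exp (-‖w‖ ^ 2) / Real.pi ^ d)) s
  simp only [e.norm_map] at h
  rw [Measure.map_apply hm hs, fockMeasure, withDensity_apply _ hs, withDensity_apply _ (hm hs)]
  exact h

/-- The mean value property of an entire function for the Gaussian measure. -/
theorem integral_fockMeasure_entire {d : ℕ} {f : Cd d → ℂ} (hf : Differentiable ℂ f)
    (hi : Integrable f (fockMeasure d)) : ∫ w, f w ∂(fockMeasure d) = f 0 := by
  have hpi : (2 * Real.pi : ℝ) ≠ 0 := by positivity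
  have h0 : (0 : ℝ) ≤ 2 * Real.pi := by positivity
  have hcm := continuous_circleMap 0 1
  have hfc := hf.continuous
  have hmp : ∀ θ : ℝ, MeasurePreserving (fun w : Cd d => circleMap 0 1 θ • w) (fockMeasure d)
      (fockMeasure d) := fun θ => measurePreserving_smul_fockMeasure d _ (by simp)
  have hemb : ∀ θ : ℝ, MeasurableEmbedding (fun w : Cd d => circleMap 0 1 θ • w) := fun θ =>
    measurableEmbedding_const_smul₀ (circleMap_ne_center one_ne_zero)
  have hrot : ∀ θ : ℝ, ∫ w, f (circleMap 0 1 θ • w) ∂(fockMeasure d)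
      = ∫ w, f w ∂(fockMeasure d) := fun θ => (hmp θ).integral_comp (hemb θ) f
  -- Averaging over rotations changes nothing; after Fubini the inner integral is a circle mean
  -- about the origin in the complex line through w.
  have h2 : ∫ θ in (0 : ℝ)..2 * Real.pi, (∫ w, f (circleMap 0 1 θ • w) ∂(fockMeasure d))
      = ∫ w, (∫ θ in (0 : ℝ)..2 * Real.pi, f (circleMap 0 1 θ • w)) ∂(fockMeasure d) := by
    simp only [intervalIntegral.integral_of_le h0]
    apply integral_integral_swap
    rw [integrable_prod_iff (Continuous.aestronglyMeasurable
      (by unfold Function.uncurry; fun_prop))]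
    refine ⟨Eventually.of_forall fun θ => (hmp θ).integrable_comp_of_integrable hi, ?_⟩
    have : ∀ θ : ℝ, ∫ w, ‖f (circleMap 0 1 θ • w)‖ ∂(fockMeasure d)
        = ∫ w, ‖f w‖ ∂(fockMeasure d) := fun θ =>
      (hmp θ).integral_comp (hemb θ) fun w => ‖f w‖
    simp only [Function.uncurry, this]
    exact integrable_const _
  simp only [hrot] at h2
  have h3 : ∀ w : Cd d, ∫ θ in (0 : ℝ)..2 * Real.pi, f (circleMap 0 1 θ • w)
      = (2 * Real.pi : ℝ) • f 0 := fun w => by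
    simpa using circle_mean_entire hf 0 w
  simp only [h3] at h2
  rw [intervalIntegral.integral_const, sub_zero, integral_const, probReal_univ, one_smul] at h2
  exact smul_right_injective ℂ hpi h2

/-- The reproducing property of the kernel functions. -/
theorem Fock.inner_fockKernel {d : ℕ} (z : Cd d) (f : Fock d) :
    inner ℂ (fockKernel z) f = f z := by
  -- Translation by z turns Gaussian times conj K_z into the Gaussian times the entire factor
  -- e^{-⟨w, z⟩}. The mean value property then gives g(0) = f(z).
  set g : Cd d → ℂ := fun w => Complex.exp (-inner ℂ z w) * f (w + z) with hg
  have hshift : ∀ w : Cd d, (Real.exp (-‖w + z‖ ^ 2) / Real.pi ^ d : ℝ) •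
      (conj (fockKernel z (w + z)) * f (w + z))
        = (Real.exp (-‖w‖ ^ 2) / Real.pi ^ d : ℝ) • g w := by
    intro w
    have h1 : conj (fockKernel z (w + z)) = Complex.exp (inner ℂ w z + inner ℂ z z) := by
      change conj (Complex.exp (inner ℂ z (w + z))) = _
      rw [← Complex.exp_conj, inner_conj_symm, inner_add_left]
    have h2 : ((-‖w + z‖ ^ 2 : ℝ) : ℂ)
        = -(inner ℂ w w + inner ℂ w z + inner ℂ z w + inner ℂ z z) := by
      have : inner ℂ (w + z) (w + z) = (‖w + z‖ : ℂ) ^ 2 := inner_self_eq_norm_sq_to_K (w + z)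
      push_cast
      rw [← this, inner_add_left, inner_add_right, inner_add_right]
      ring
    have h3 : ((-‖w‖ ^ 2 : ℝ) : ℂ) = -inner ℂ w w := by
      rw [inner_self_eq_norm_sq_to_K]; push_cast; rfl
    have h4 : Complex.exp ((-‖w + z‖ ^ 2 : ℝ) : ℂ) * Complex.exp (inner ℂ w z + inner ℂ z z)
        = Complex.exp ((-‖w‖ ^ 2 : ℝ) : ℂ) * Complex.exp (-inner ℂ z w) := by
      rw [← Complex.exp_add, ← Complex.exp_add, h2, h3]
      congr 1
      ring
    rw [h1, hg, Complex.real_smul, Complex.real_smul, Complex.ofReal_div, Complex.ofReal_div,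
      Complex.ofReal_exp, Complex.ofReal_exp]
    linear_combination ((Real.pi ^ d : ℝ) : ℂ)⁻¹ * f (w + z) * h4
  have hgd : Differentiable ℂ g := by
    have h1 : Differentiable ℂ fun w : Cd d => inner ℂ z w := (innerSL ℂ z).differentiable
    have h2 := f.differentiable
    fun_prop
  have hi : Integrable (fun w => conj (fockKernel z w) * f w) (fockMeasure d) := by
    have := L2.integrable_inner (𝕜 := ℂ) (Fock.toL2 (fockKernel z)) (Fock.toL2 f)
    refine this.congr ?_
    filter_upwards [Fock.coeFn_toL2 (fockKernel z), Fock.coeFn_toL2 f] with w h1 h2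
    rw [h1, h2, RCLike.inner_apply, mul_comm]
  have hgi : Integrable g (fockMeasure d) := by
    rw [integrable_fockMeasure_iff] at hi ⊢
    refine (hi.comp_add_right z).congr (Eventually.of_forall fun w => hshift w)
  rw [Fock.inner_eq, integral_fockMeasure, ← integral_add_right_eq_self _ z]
  simp only [hshift]
  rw [← integral_fockMeasure, integral_fockMeasure_entire hgd hgi]
  simp [hg]

namespace Fock

variable {d : ℕ}

theorem inner_right_fockKernel (z : Cd d) (f : Fock d) :
    inner ℂ f (fockKernel z) = conj (f z) := by
  rw [← inner_conj_symm, inner_fockKernel]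

/-- Cauchy–Schwarz against the kernel, with ‖K_z‖² = K_z(z). This is the growth hypothesis needed
for the eigenvalue equation. -/
theorem norm_apply_le (f : Fock d) (z : Cd d) : ‖f z‖ ≤ ‖f‖ * Real.exp (‖z‖ ^ 2 / 2) := by
  have h1 : ‖fockKernel z‖ = Real.exp (‖z‖ ^ 2 / 2) := by
    have h2 : ‖fockKernel z‖ ^ 2 = Real.exp (‖z‖ ^ 2) := by
      have h3 : inner ℂ (fockKernel z) (fockKernel z) = Complex.exp (inner ℂ z z) :=
        inner_fockKernel z _
      rw [inner_self_eq_norm_sq_to_K, inner_self_eq_norm_sq_to_K] at h3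
      change (‖fockKernel z‖ : ℂ) ^ 2 = Complex.exp ((‖z‖ : ℂ) ^ 2) at h3
      exact_mod_cast h3
    rw [← sq_eq_sq₀ (norm_nonneg _) (Real.exp_pos _).le, h2, ← Real.exp_nat_mul]
    congr 1; push_cast; ring
  rw [← h1, ← inner_fockKernel z f, mul_comm]
  exact norm_inner_le_norm _ _

theorem eq_zero_of_forall_inner_fockKernel {f : Fock d}
    (h : ∀ z, inner ℂ (fockKernel z) f = 0) : f = 0 := by
  apply DFunLike.coe_injective
  funext z
  rw [← inner_fockKernel, h]; rfl

variable (d) in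
/-- The linear span of the kernel functions. -/
def kernelSpan : Submodule ℂ (Fock d) := Submodule.span ℂ (Set.range fockKernel)

theorem dense_kernelSpan : Dense (kernelSpan d : Set (Fock d)) := by
  rw [Submodule.dense_iff_topologicalClosure_eq_top, Submodule.topologicalClosure_eq_top_iff,
    Submodule.eq_bot_iff]
  intro f hf
  refine eq_zero_of_forall_inner_fockKernel fun z => ?_
  exact hf _ (Submodule.subset_span ⟨z, rfl⟩)

end Fock

/-! ### Symmetry from vanishing deficiency spaces -/

/-- A closed operator on a complex Hilbert space is symmetric if it is symmetric against a
subspace of its domain on which the deficiency indices vanish. -/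
theorem LinearPMap.isFormalAdjoint_self_of_deficiency_eq_zero {H : Type*} [NormedAddCommGroup H]
    [InnerProductSpace ℂ H] [CompleteSpace H] {T : H →ₗ.[ℂ] H} (hcl : T.IsClosed)
    (S : Submodule ℂ T.domain)
    (hsymm : ∀ x ∈ S, ∀ y : T.domain, inner ℂ (T x) (y : H) = inner ℂ (x : H) (T y))
    (hdef : ∀ l : ℂ, l.im ≠ 0 → ∀ y : H,
      (∀ x ∈ S, inner ℂ (T x) y = l * inner ℂ (x : H) y) → y = 0) : T.IsFormalAdjoint T := by
  set M : Submodule ℂ H := S.map (T.toFun - Complex.I • T.domain.subtype) with hM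
  -- A vector orthogonal to (T - i)S solves the deficiency equation for l = -i.
  have hMtop : M.topologicalClosure = ⊤ := by
    rw [Submodule.topologicalClosure_eq_top_iff, Submodule.eq_bot_iff]
    intro y hy
    refine hdef (-Complex.I) (by simp) y fun x hx => ?_
    have h1 : inner ℂ (T x - Complex.I • (x : H)) y = 0 := hy _ ⟨x, hx, rfl⟩
    rw [inner_sub_left, inner_smul_left, Complex.conj_I, sub_eq_zero] at h1
    exact h1
  -- Symmetry removes the cross term. Hence if (T - i)uₙ converges, both uₙ and Tuₙ are Cauchy, and
  -- closedness puts the limit in the domain.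
  have hnorm : ∀ x ∈ S, ‖T x - Complex.I • (x : H)‖ ^ 2 = ‖T x‖ ^ 2 + ‖(x : H)‖ ^ 2 := by
    intro x hx
    have h1 : (inner ℂ (T x) (Complex.I • (x : H))).re = 0 := by
      have h2 : (inner ℂ (T x) (x : H)).im = 0 := by
        rw [← Complex.conj_eq_iff_im, inner_conj_symm, hsymm x hx x]
      rw [inner_smul_right]
      simp [h2]
    rw [@norm_sub_sq ℂ, norm_smul, Complex.norm_I, one_mul]
    simp only [RCLike.re_eq_complex_re, h1]
    ring
  intro f g
  have hf : T f - Complex.I • (f : H) ∈ _root_.closure (M : Set H) := by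
    rw [← Submodule.topologicalClosure_coe, hMtop]; trivial
  obtain ⟨v, hvM, hv⟩ := mem_closure_iff_seq_limit.1 hf
  choose u hu huv using hvM
  have hv' : ∀ n, v n = T (u n) - Complex.I • (u n : H) := fun n => (huv n).symm
  have hdiff : ∀ m n, ‖v m - v n‖ ^ 2
      = ‖T (u m) - T (u n)‖ ^ 2 + ‖(u m : H) - (u n : H)‖ ^ 2 := by
    intro m n
    have h1 := hnorm (u m - u n) (S.sub_mem (hu m) (hu n))
    rw [T.map_sub, Submodule.coe_sub] at h1
    rw [← h1, hv', hv', smul_sub]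
    congr 2
    abel
  have hcv := hv.cauchySeq
  have hcauchy : ∀ w : ℕ → H, (∀ m n, ‖w m - w n‖ ≤ ‖v m - v n‖) → CauchySeq w := by
    intro w hw
    rw [Metric.cauchySeq_iff] at hcv ⊢
    intro ε hε
    obtain ⟨N, hN⟩ := hcv ε hε
    refine ⟨N, fun m hm n hn => ?_⟩
    have := hN m hm n hn
    rw [dist_eq_norm] at this ⊢
    exact (hw m n).trans_lt this
  obtain ⟨a, ha⟩ := cauchySeq_tendsto_of_complete (hcauchy (fun n => (u n : H)) fun m n =>
    (sq_le_sq₀ (norm_nonneg _) (norm_nonneg _)).1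
      (by rw [hdiff]; exact le_add_of_nonneg_left (sq_nonneg _)))
  obtain ⟨b, hb⟩ := cauchySeq_tendsto_of_complete (hcauchy (fun n => T (u n)) fun m n =>
    (sq_le_sq₀ (norm_nonneg _) (norm_nonneg _)).1
      (by rw [hdiff]; exact le_add_of_nonneg_right (sq_nonneg _)))
  have hab : (a, b) ∈ T.graph := hcl.mem_of_tendsto (ha.prodMk_nhds hb)
    (Eventually.of_forall fun n => T.mem_graph (u n))
  obtain ⟨y, hya, hyb⟩ := (T.mem_graph_iff).1 hab
  simp only at hya hyb
  have hlim : T f - Complex.I • (f : H) = b - Complex.I • a :=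
    tendsto_nhds_unique hv ((hb.sub (ha.const_smul Complex.I)).congr fun n => (hv' n).symm)
  -- The limit has the same image as f under T - i, so their difference is an eigenvector for i;
  -- pairing it with S puts it in the other deficiency space. Thus f is a graph limit of elements of
  -- S, and symmetry passes to the limit.
  have hfy : (f : H) - a = 0 := by
    refine hdef Complex.I (by simp) _ fun x hx => ?_
    have h1 : T (f - y) = Complex.I • ((f : H) - a) := by
      rw [T.map_sub, hyb, smul_sub]
      rw [sub_eq_sub_iff_add_eq_add] at hlim ⊢
      rw [hlim]; abel
    have h2 := hsymm x hx (f - y)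
    rwa [h1, inner_smul_right, Submodule.coe_sub, hya] at h2
  rw [sub_eq_zero] at hfy
  have hfb : T f = b := by
    rw [hfy] at hlim
    exact sub_left_injective hlim
  rw [hfy, hfb]
  exact tendsto_nhds_unique (hb.inner tendsto_const_nhds)
    ((ha.inner tendsto_const_nhds).congr fun n => (hsymm _ (hu n) g).symm)

/-! ### Maximal operators and their adjoints -/

namespace Fock

variable {d : ℕ} {ψ : Cd d → ℂ} {φ : Cd d → Cd d}

theorem fockKernel_apply (z u : Cd d) : fockKernel z u = Complex.exp (inner ℂ z u) := rfl

theorem maxWCO_apply (f : (maxWCO ψ φ).domain) (z : Cd d) :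
    maxWCO ψ φ f z = ψ z * (f : Fock d) (φ z) := rfl

theorem continuous_eval (z : Cd d) : Continuous fun f : Fock d => f z := by
  simp only [← inner_fockKernel]
  fun_prop

/-- Maximal weighted composition operators are closed. -/
theorem isClosed_maxWCO (ψ : Cd d → ℂ) (φ : Cd d → Cd d) : (maxWCO ψ φ).IsClosed := by
  -- Maximality of the domain lets pointwise equations cut out the graph; each is a closed condition
  -- because evaluations are continuous.
  have : ((maxWCO ψ φ).graph : Set (Fock d × Fock d))
      = ⋂ z, {p | p.2 z = ψ z * p.1 (φ z)} := by
    ext ⟨f, g⟩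
    simp only [SetLike.mem_coe, LinearPMap.mem_graph_iff, Set.mem_iInter, Set.mem_ofPred_eq]
    constructor
    · rintro ⟨y, rfl, rfl⟩ z
      rfl
    · intro h
      have h1 : (fun z => ψ z * f (φ z)) = g := funext fun z => (h z).symm
      have hf : f ∈ (maxWCO ψ φ).domain := by
        change (fun z => ψ z * f (φ z)) ∈ fockSubmodule d
        rw [h1]
        exact g.mem
      exact ⟨⟨f, hf⟩, rfl, DFunLike.coe_injective h1⟩
  rw [LinearPMap.IsClosed, this]
  exact isClosed_iInter fun z => isClosed_eq ((continuous_eval z).comp continuous_snd)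
    (((continuous_eval (φ z)).comp continuous_fst).const_mul (ψ z))

theorem dense_domain_of_fockKernel_mem (hker : ∀ z : Cd d, fockKernel z ∈ (maxWCO ψ φ).domain) :
    Dense ((maxWCO ψ φ).domain : Set (Fock d)) :=
  dense_kernelSpan.mono (Submodule.span_le.2 (by rintro _ ⟨z, rfl⟩; exact hker z))

section Affine

variable {A : Cd d →ₗ[ℂ] Cd d} {q : Cd d}

/-- The image of a kernel function is again a multiple of a kernel function. -/
theorem exp_mul_fockKernel (hA : A.IsSymmetric) (z u : Cd d) :
    Complex.exp (inner ℂ q u) * fockKernel z (A u + q)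
      = Complex.exp (inner ℂ z q) * fockKernel (A z + q) u := by
  rw [fockKernel_apply, fockKernel_apply, ← Complex.exp_add, ← Complex.exp_add, inner_add_right,
    inner_add_left, hA]
  congr 1
  ring

theorem fockKernel_mem_domain (hA : A.IsSymmetric) (z : Cd d) :
    fockKernel z ∈ (maxWCO (fun z => Complex.exp (inner ℂ q z)) (fun z => A z + q)).domain := by
  have h : (fun u => Complex.exp (inner ℂ q u) * fockKernel z (A u + q))
      = ⇑(Complex.exp (inner ℂ z q) • fockKernel (A z + q)) :=
    funext fun u => exp_mul_fockKernel hA z u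
  change (fun u => Complex.exp (inner ℂ q u) * fockKernel z (A u + q)) ∈ fockSubmodule d
  rw [h]
  exact mem _

theorem inner_maxWCO_fockKernel (hA : A.IsSymmetric) (z : Cd d) (y : Fock d) :
    inner ℂ (maxWCO (fun z => Complex.exp (inner ℂ q z)) (fun z => A z + q)
      ⟨fockKernel z, fockKernel_mem_domain hA z⟩) y = Complex.exp (inner ℂ q z) * y (A z + q) := by
  have h : maxWCO (fun z => Complex.exp (inner ℂ q z)) (fun z => A z + q)
      ⟨fockKernel z, fockKernel_mem_domain hA z⟩
      = Complex.exp (inner ℂ z q) • fockKernel (A z + q) :=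
    DFunLike.coe_injective (funext fun u => exp_mul_fockKernel hA z u)
  rw [h, inner_smul_left, inner_fockKernel, ← Complex.exp_conj, inner_conj_symm]

/-- The maximal weighted composition operator with symbols `e^{⟨·, q⟩}` and `A · + q` with
symmetric `A` is symmetric. -/
theorem isFormalAdjoint_maxWCO_exp (hA : A.IsSymmetric) :
    (maxWCO (fun z => Complex.exp (inner ℂ q z)) (fun z => A z + q)).IsFormalAdjoint
      (maxWCO (fun z => Complex.exp (inner ℂ q z)) (fun z => A z + q)) := by
  refine LinearPMap.isFormalAdjoint_self_of_deficiency_eq_zero (isClosed_maxWCO _ _)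
    (Submodule.span ℂ (Set.range fun z => ⟨fockKernel z, fockKernel_mem_domain hA z⟩)) ?_ ?_
  · intro x hx y
    induction hx using Submodule.span_induction with
    | mem x hx =>
      obtain ⟨z, rfl⟩ := hx
      rw [inner_maxWCO_fockKernel hA, inner_fockKernel]
      rfl
    | zero => simp
    | add x x' _ _ h h' =>
      rw [LinearPMap.map_add, inner_add_left, h, h', Submodule.coe_add, inner_add_left]
    | smul c x _ h =>
      rw [LinearPMap.map_smul, inner_smul_left, h, Submodule.coe_smul, inner_smul_left]
  · intro l hl y hy
    apply DFunLike.coe_injective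
    -- Tested on K_w, the deficiency equation is the eigenvalue equation at the point w.
    refine eq_zero_of_shift_eigenvalue (q := q) hA y.differentiable y.norm_apply_le hl fun w => ?_
    rw [← inner_maxWCO_fockKernel hA, hy _ (Submodule.subset_span ⟨w, rfl⟩), inner_fockKernel]

/-- The adjoint of a maximal weighted composition operator with affine symmetric symbol. -/
theorem adjoint_maxWCO_eq_smul (hA : A.IsSymmetric) {θ ε : ℂ} (hθ : θ ≠ 0)
    (hε : conj θ = ε * θ) (hψ : ∀ z, ψ z = θ * Complex.exp (inner ℂ q z))
    (hφ : ∀ z, φ z = A z + q) (hker : ∀ z : Cd d, fockKernel z ∈ (maxWCO ψ φ).domain) :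
    (maxWCO ψ φ).adjoint = ε • maxWCO ψ φ := by
  obtain rfl : φ = fun z => A z + q := funext hφ
  have hdense := dense_domain_of_fockKernel_mem hker
  set T := maxWCO ψ (fun z => A z + q) with hT
  set T₁ := maxWCO (fun z => Complex.exp (inner ℂ q z)) (fun z => A z + q) with hT₁
  have hfun : ∀ f : Fock d, (fun z => ψ z * f (A z + q))
      = θ • fun z => Complex.exp (inner ℂ q z) * f (A z + q) := by
    intro f
    funext z
    simp [hψ, mul_assoc]
  have hdom : ∀ f ∈ T.domain, f ∈ T₁.domain := by
    intro f hf
    have h1 : (fun z => ψ z * f (A z + q)) ∈ fockSubmodule d := hf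
    rw [hfun] at h1
    exact (Submodule.smul_mem_iff (fockSubmodule d) hθ).1 h1
  have hTT₁ : ∀ f : T.domain, T f = θ • T₁ ⟨f, hdom f f.2⟩ := fun f =>
    DFunLike.coe_injective (hfun f)
  -- Testing T* on kernels shows that it acts as εT, and maximality gives the domain inclusion. The
  -- converse is the symmetry of the operator with θ = 1, rescaled.
  refine le_antisymm ?_ (LinearPMap.IsFormalAdjoint.le_adjoint hdense fun x y => ?_)
  · have hval : ∀ (y : T.adjoint.domain) z, T.adjoint y z = ε * (ψ z * (y : Fock d) (A z + q)) := by
      intro y z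
      have h1 := (LinearPMap.adjoint_isFormalAdjoint hdense).symm ⟨fockKernel z, hker z⟩ y
      rw [inner_fockKernel, hTT₁, inner_smul_left, inner_maxWCO_fockKernel hA] at h1
      rw [← h1, hψ, hε]
      ring
    have hε0 : ε ≠ 0 := by
      rintro rfl
      rw [zero_mul, map_eq_zero] at hε
      exact hθ hε
    have hmem : ∀ y : T.adjoint.domain, (y : Fock d) ∈ T.domain := by
      intro y
      have h1 : ε • (fun z => ψ z * (y : Fock d) (A z + q)) = ⇑(T.adjoint y) :=
        funext fun z => (hval y z).symm
      change (fun z => ψ z * (y : Fock d) (A z + q)) ∈ fockSubmodule d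
      rw [← Submodule.smul_mem_iff _ hε0, h1]
      exact mem _
    refine ⟨fun y hy => hmem ⟨y, hy⟩, fun x y hxy => ?_⟩
    apply DFunLike.coe_injective
    funext z
    rw [hval, hxy]
    rfl
  · have h1 := isFormalAdjoint_maxWCO_exp hA (q := q) ⟨x, hdom x x.2⟩ ⟨y, hdom y y.2⟩
    rw [LinearPMap.smul_apply, hTT₁, hTT₁, inner_smul_left, inner_smul_right, inner_smul_right, h1,
      hε]
    ring

end Affine

end Fock

/-! ### Recovering the symbols from the kernel identity -/

/-- A continuous logarithm of the constant function one on a connected space is zero if it has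
a zero. -/
theorem eq_zero_of_exp_eq_one {X : Type*} [TopologicalSpace X] [PreconnectedSpace X] {D : X → ℂ}
    (hD : Continuous D) (hexp : ∀ x, Complex.exp (D x) = 1) {x₀ : X} (h0 : D x₀ = 0) (x : X) :
    D x = 0 := by
  choose n hn using fun x => Complex.exp_eq_one_iff.1 (hexp x)
  have hcont : Continuous n := by
    rw [Int.isClosedEmbedding_coe_real.isEmbedding.continuous_iff]
    have : ((↑) : ℤ → ℝ) ∘ n = fun x => (D x / (2 * Real.pi * Complex.I)).re := by
      funext x
      rw [hn, mul_div_cancel_right₀ _ Complex.two_pi_I_ne_zero]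
      simp
    rw [this]
    fun_prop
  have h1 : n x = n x₀ := PreconnectedSpace.constant ‹_› hcont
  rw [hn x, h1, ← hn x₀, h0]

/-- A map that is symmetric for the inner product is linear. -/
theorem exists_linearMap_of_symmetric {E : Type*} [NormedAddCommGroup E] [InnerProductSpace ℂ E]
    {F : E → E} (hF : ∀ w z, inner ℂ (F w) z = (inner ℂ w (F z) : ℂ)) :
    ∃ A : E →ₗ[ℂ] E, A.IsSymmetric ∧ ∀ z, F z = A z :=
  ⟨{  toFun := F
      map_add' := fun x y => ext_inner_right ℂ fun z => by
        rw [inner_add_left, hF, hF, hF, inner_add_left]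
      map_smul' := fun c x => ext_inner_right ℂ fun z => by
        rw [RingHom.id_apply, inner_smul_left, hF, hF, inner_smul_left] }, hF, fun _ => rfl⟩

/-- Only the values on kernels matter: the reproducing property makes the hypothesis a functional
equation for ψ and φ. The parameter ε treats the self-adjoint and skew cases together. -/
theorem exists_affine_of_inner_fockKernel {d : ℕ} {ψ : Cd d → ℂ} {φ : Cd d → Cd d}
    (hψ0 : ψ ≠ 0) (hφ : Continuous φ)
    (hker : ∀ z : Cd d, fockKernel z ∈ (maxWCO ψ φ).domain) {ε : ℂ} (hε0 : ε ≠ 0)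
    (hε : ∀ z w : Cd d, inner ℂ (maxWCO ψ φ ⟨fockKernel z, hker z⟩) (fockKernel w)
      = ε * inner ℂ (fockKernel z) (maxWCO ψ φ ⟨fockKernel w, hker w⟩)) :
    ∃ (Q : Matrix (Fin d) (Fin d) ℂ) (q : Cd d) (θ : ℂ),
      Q = Q.conjTranspose ∧ conj θ = ε * θ ∧
      (∀ z, ψ z = θ * Complex.exp (inner ℂ q z)) ∧
      (∀ z, φ z = Matrix.toEuclideanLin Q z + q) := by
  have hrel : ∀ z w : Cd d, conj (ψ w) * Complex.exp (inner ℂ (φ w) z)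
      = ε * (ψ z * Complex.exp (inner ℂ w (φ z))) := by
    intro z w
    have := hε z w
    rw [Fock.inner_right_fockKernel, Fock.inner_fockKernel, Fock.maxWCO_apply, Fock.maxWCO_apply,
      Fock.fockKernel_apply, Fock.fockKernel_apply, map_mul, ← Complex.exp_conj,
      inner_conj_symm] at this
    exact this
  have hθ : conj (ψ 0) = ε * ψ 0 := by simpa using hrel 0 0
  have hψ : ∀ z, ψ z = ψ 0 * Complex.exp (inner ℂ (φ 0) z) := by
    intro z
    have := hrel z 0
    rw [inner_zero_left, Complex.exp_zero, mul_one, hθ, mul_assoc] at this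
    exact (mul_left_cancel₀ hε0 this).symm
  have hθ0 : ψ 0 ≠ 0 := by
    intro h
    apply hψ0
    funext z
    rw [hψ, h, zero_mul]; rfl
  -- After cancelling ε and ψ(0), the exponents agree modulo 2πi; their difference is continuous on
  -- a connected space and zero at the origin.
  have hzero : ∀ p : Cd d × Cd d,
      inner ℂ (φ p.1 - φ 0) p.2 - (inner ℂ p.1 (φ p.2 - φ 0) : ℂ) = 0 := by
    refine eq_zero_of_exp_eq_one (x₀ := (0, 0)) (by fun_prop) (fun p => ?_) (by simp)
    have h1 := hrel p.2 p.1
    rw [hψ p.1, hψ p.2, map_mul, hθ, ← Complex.exp_conj, inner_conj_symm, mul_assoc, mul_assoc,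
      mul_assoc] at h1
    have h2 := mul_left_cancel₀ hθ0 (mul_left_cancel₀ hε0 h1)
    rw [← Complex.exp_add, ← Complex.exp_add] at h2
    have h3 : ∀ a b c e : ℂ, a - b - (c - e) = (e + a) - (b + c) := fun a b c e => by ring
    rw [inner_sub_left, inner_sub_right, h3, Complex.exp_sub, h2, div_self (Complex.exp_ne_zero _)]
  obtain ⟨A, hA, hFA⟩ := exists_linearMap_of_symmetric (F := fun z => φ z - φ 0)
    fun w z => sub_eq_zero.1 (hzero (w, z))
  refine ⟨Matrix.toEuclideanLin.symm A, φ 0, ψ 0, ?_, hθ, hψ, fun z => ?_⟩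
  · have : (Matrix.toEuclideanLin.symm A).IsHermitian := by
      rw [← Matrix.isSymmetric_toEuclideanLin_iff, LinearEquiv.apply_symm_apply]
      exact hA
    exact this.symm
  · rw [LinearEquiv.apply_symm_apply, ← hFA, sub_add_cancel]

theorem adjoint_maxWCO_eq_smul_of_isHermitian {d : ℕ} {ψ : Cd d → ℂ} {φ : Cd d → Cd d}
    (hψ0 : ψ ≠ 0) (hker : ∀ z : Cd d, fockKernel z ∈ (maxWCO ψ φ).domain) {ε : ℂ}
    {Q : Matrix (Fin d) (Fin d) ℂ} {q : Cd d} {θ : ℂ} (hQ : Q = Q.conjTranspose)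
    (hε : conj θ = ε * θ) (hψ : ∀ z, ψ z = θ * Complex.exp (inner ℂ q z))
    (hφ : ∀ z, φ z = Matrix.toEuclideanLin Q z + q) :
    (maxWCO ψ φ).adjoint = ε • maxWCO ψ φ := by
  refine Fock.adjoint_maxWCO_eq_smul (Matrix.isSymmetric_toEuclideanLin_iff.2 hQ.symm) ?_ hε
    hψ hφ hker
  rintro rfl
  exact hψ0 (funext fun z => by rw [hψ, zero_mul]; rfl)

/-! ### The two equivalences, as the cases ε = 1 and ε = -1 -/

theorem corollary2p4 (d : ℕ) (ψ : Cd d → ℂ) (φ : Cd d → Cd d)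
    (hψ : Differentiable ℂ ψ) (hψ0 : ψ ≠ 0) (hφ : Differentiable ℂ φ)
    (hker : ∀ z : Cd d, fockKernel z ∈ (maxWCO ψ φ).domain) :
    List.TFAE
      [maxWCO ψ φ = (maxWCO ψ φ).adjoint,
       maxWCO ψ φ ≤ (maxWCO ψ φ).adjoint,
       ∃ (Q : Matrix (Fin d) (Fin d) ℂ) (q : Cd d) (θ : ℂ),
         Q = Q.conjTranspose ∧ θ.im = 0 ∧
         (∀ z, ψ z = θ * Complex.exp (inner ℂ q z)) ∧
         (∀ z, φ z = Matrix.toEuclideanLin Q z + q)] ∧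
    List.TFAE
      [maxWCO ψ φ = -(maxWCO ψ φ).adjoint,
       maxWCO ψ φ ≤ -(maxWCO ψ φ).adjoint,
       ∃ (Q : Matrix (Fin d) (Fin d) ℂ) (q : Cd d) (θ : ℂ),
         Q = Q.conjTranspose ∧ θ.re = 0 ∧
         (∀ z, ψ z = θ * Complex.exp (inner ℂ q z)) ∧
         (∀ z, φ z = Matrix.toEuclideanLin Q z + q)] := by
  have hdense := Fock.dense_domain_of_fockKernel_mem hker
  constructor
  · tfae_have 1 → 2 := fun h => le_of_eq h
    tfae_have 2 → 3 := by
      intro h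
      obtain ⟨Q, q, θ, hQ, hθ, h1, h2⟩ := exists_affine_of_inner_fockKernel hψ0 hφ.continuous hker
        (ε := 1) one_ne_zero fun z w => by
          obtain ⟨y, hy, hyT⟩ := LinearPMap.exists_of_le h ⟨fockKernel z, hker z⟩
          rw [hyT, one_mul]
          have := LinearPMap.adjoint_isFormalAdjoint hdense y ⟨fockKernel w, hker w⟩
          rwa [← hy] at this
      exact ⟨Q, q, θ, hQ, Complex.conj_eq_iff_im.1 (by rw [hθ, one_mul]), h1, h2⟩
    tfae_have 3 → 1 := by
      rintro ⟨Q, q, θ, hQ, hθ, h1, h2⟩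
      rw [adjoint_maxWCO_eq_smul_of_isHermitian hψ0 hker (ε := 1) hQ
        (by rw [one_mul, Complex.conj_eq_iff_im.2 hθ]) h1 h2, one_smul]
    tfae_finish
  · tfae_have 1 → 2 := fun h => le_of_eq h
    tfae_have 2 → 3 := by
      intro h
      obtain ⟨Q, q, θ, hQ, hθ, h1, h2⟩ := exists_affine_of_inner_fockKernel hψ0 hφ.continuous hker
        (ε := -1) (neg_ne_zero.2 one_ne_zero) fun z w => by
          obtain ⟨y, hy, hyT⟩ := LinearPMap.exists_of_le h ⟨fockKernel z, hker z⟩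
          rw [hyT, neg_one_mul, LinearPMap.neg_apply, inner_neg_left]
          have := LinearPMap.adjoint_isFormalAdjoint hdense y ⟨fockKernel w, hker w⟩
          rw [← hy] at this
          exact congrArg Neg.neg this
      refine ⟨Q, q, θ, hQ, ?_, h1, h2⟩
      have := congrArg Complex.re hθ
      simp only [Complex.conj_re, neg_one_mul, Complex.neg_re] at this
      linarith
    tfae_have 3 → 1 := by
      rintro ⟨Q, q, θ, hQ, hθ, h1, h2⟩
      have hθ' : conj θ = -1 * θ := by
        apply Complex.ext <;> simp [hθ]
      rw [adjoint_maxWCO_eq_smul_of_isHermitian hψ0 hker (ε := -1) hQ hθ' h1 h2]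
      refine LinearPMap.ext rfl fun x _ _ => ?_
      rw [LinearPMap.neg_apply, LinearPMap.smul_apply, neg_one_smul, neg_neg]
    tfae_finish
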